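/- Let $K$ be a field and let $I_1,\dots,I_k$ be monomial ideals in $K[x_1,\dots,x_n]$. The cloud $A_i\subseteq\mathbb{N}^n$ of $I_i$ is the set of exponent vectors of the minimal system of monomial generators of $I_i$. Two clouds $A,B$ are called transverse if their affine hulls in $\mathbb{R}^n$ lie in complementary coordinate subspaces, that is, if after a permutation of the coordinates $A\subseteq\mathbb{N}^s\times 0^{n-s}$ and $B\subseteq 0^s\times\mathbb{N}^{n-s}$ for some $0\le s\le n$ (equivalently, no variable divides both a minimal generator of the one ideal and a minimal generator of the other). An ideal $I$ is called tame if the blowup of $\mathbb{A}^n_K=\operatorname{Spec}K[x_1,\dots,x_n]$ in $I$, i.e. $\operatorname{Proj}\bigoplus_{m\ge 0}I^m$, is smooth over $K$. If the clouds $A_1,\dots,A_k$ are pairwise transverse and each $I_i$ is tame, then the product $\prod_{i=1}^k I_i$ is tame. -/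

import Mathlib

noncomputable section

namespace TameBlowup

open AlgebraicGeometry CategoryTheory

/-! ### The blowup of an affine scheme in an ideal -/

section Blowup

universe u

variable {R : Type u} [CommRing R]

/-- The degree `m` part `I ^ m * t ^ m` of the Rees algebra `R[It] = ⨁ I ^ m * t ^ m`. -/
def reesGrading (I : Ideal R) (m : ℕ) : Submodule R (reesAlgebra I) :=
  (LinearMap.range (Polynomial.monomial (R := R) m)).comap (reesAlgebra I).val.toLinearMap

theorem mem_reesGrading_iff {I : Ideal R} {m : ℕ} {f : reesAlgebra I} :
    f ∈ reesGrading I m ↔ Polynomial.monomial m ((f : Polynomial R).coeff m) = f := by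
  constructor
  · rintro ⟨r, hr⟩
    have hr' : Polynomial.monomial m r = (f : Polynomial R) := hr
    rw [← hr', Polynomial.coeff_monomial_same]
  · intro h
    exact ⟨_, h⟩

/-- The degree `m` component of an element of the Rees algebra. -/
def reesComponent (I : Ideal R) (m : ℕ) : reesAlgebra I →+ reesGrading I m where
  toFun f := ⟨⟨Polynomial.monomial m ((f : Polynomial R).coeff m),
    reesAlgebra.monomial_mem.2 (f.2 m)⟩, ⟨_, rfl⟩⟩
  map_zero' := by
    apply Subtype.ext
    apply Subtype.ext
    simp
  map_add' f g := by
    apply Subtype.ext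
    apply Subtype.ext
    simp

theorem coe_reesComponent (I : Ideal R) (m : ℕ) (f : reesAlgebra I) :
    ((reesComponent I m f : reesAlgebra I) : Polynomial R)
      = Polynomial.monomial m ((f : Polynomial R).coeff m) := rfl

instance reesGradedMonoid (I : Ideal R) : SetLike.GradedMonoid (reesGrading I) where
  one_mem := ⟨1, rfl⟩
  mul_mem := by
    rintro i j f g ⟨r, hr⟩ ⟨s, hs⟩
    have hr' : Polynomial.monomial i r = (f : Polynomial R) := hr
    have hs' : Polynomial.monomial j s = (g : Polynomial R) := hs
    refine ⟨r * s, ?_⟩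
    change Polynomial.monomial (i + j) (r * s) = (f : Polynomial R) * (g : Polynomial R)
    rw [← hr', ← hs', Polynomial.monomial_mul_monomial]

theorem reesGrading_isInternal (I : Ideal R) : DirectSum.IsInternal (reesGrading I) := by
  classical
  have key : ∀ (x : DirectSum ℕ fun i => reesGrading I i) (m : ℕ),
      reesComponent I m (DirectSum.coeAddMonoidHom (reesGrading I) x) = x m := by
    intro x m
    induction x using DirectSum.induction_on with
    | zero => simp
    | of i y =>
      rw [DirectSum.coeAddMonoidHom_of]
      apply Subtype.ext
      apply Subtype.ext
      rw [coe_reesComponent]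
      have hy := mem_reesGrading_iff.1 y.2
      by_cases h : i = m
      · subst h
        rw [DirectSum.of_eq_same, hy]
      · rw [DirectSum.of_eq_of_ne _ _ _ (Ne.symm h), ← hy, Polynomial.coeff_monomial_of_ne _ (Ne.symm h)]
        simp
    | add x y hx hy => rw [map_add, map_add, hx, hy, DirectSum.add_apply]
  constructor
  · intro x y h
    apply DFinsupp.ext
    intro m
    rw [← key x m, ← key y m, h]
  · intro f
    refine ⟨∑ i ∈ (f : Polynomial R).support,
      DirectSum.of (fun i => reesGrading I i) i (reesComponent I i f), ?_⟩
    rw [map_sum]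
    apply Subtype.ext
    simp only [DirectSum.coeAddMonoidHom_of, AddSubmonoidClass.coe_finsetSum, coe_reesComponent]
    exact ((f : Polynomial R).as_sum_support).symm

instance reesDecomposition (I : Ideal R) : DirectSum.Decomposition (reesGrading I) :=
  (reesGrading_isInternal I).chooseDecomposition

instance reesGradedAlgebra (I : Ideal R) : GradedAlgebra (reesGrading I) where

/-- The blowup `Proj (⨁ I ^ m * t ^ m)` of `Spec R` in the ideal `I`. -/
def blowup (I : Ideal R) : Scheme.{u} :=
  Proj (reesGrading I)

/-- The blowup map to `Spec R`. -/
def blowupMap (I : Ideal R) : blowup I ⟶ Spec (CommRingCat.of R) :=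
  Proj.toSpecZero (reesGrading I) ≫
    Spec.map (CommRingCat.ofHom (algebraMap R (reesGrading I 0)))

end Blowup

/-! ### Tame ideals, clouds and transversality -/

section Monomial

variable {K : Type*} [Field K] {n : ℕ}

/-- An ideal `I` of `K[x₁, …, xₙ]` is tame if the blowup of affine space `𝔸ⁿ = Spec K[x₁, …, xₙ]`
in `I` is smooth over `K`. -/
def IsTame (I : Ideal (MvPolynomial (Fin n) K)) : Prop :=
  Smooth (blowupMap I ≫
    Spec.map (CommRingCat.ofHom (algebraMap K (MvPolynomial (Fin n) K))))

/-- The ideal generated by the monomials with exponent vectors in `A`. -/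
def monomialIdeal (K : Type*) [Field K] (A : Set (Fin n →₀ ℕ)) :
    Ideal (MvPolynomial (Fin n) K) :=
  Ideal.span ((fun a => MvPolynomial.monomial a (1 : K)) '' A)

/-- `A` is the cloud of `I`: it is the set of exponent vectors of a minimal system of monomial
generators of `I`. In particular `I` is a monomial ideal. -/
def IsCloud (A : Set (Fin n →₀ ℕ)) (I : Ideal (MvPolynomial (Fin n) K)) : Prop :=
  Minimal (fun B : Set (Fin n →₀ ℕ) => monomialIdeal K B = I) A

/-- The affine hull in `ℝⁿ` of a set of exponent vectors. -/
def affineHull (A : Set (Fin n →₀ ℕ)) : AffineSubspace ℝ (Fin n → ℝ) :=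
  affineSpan ℝ ((fun (a : Fin n →₀ ℕ) (i : Fin n) => (a i : ℝ)) '' A)

/-- The coordinate subspace of `ℝⁿ` spanned by the standard basis vectors `eᵢ`, `i ∈ S`. -/
def coordSubspace (S : Set (Fin n)) : Submodule ℝ (Fin n → ℝ) :=
  Submodule.span ℝ ((fun i => Pi.single i (1 : ℝ)) '' S)

/-- Two sets of exponent vectors are transverse if their affine hulls lie in complementary
coordinate subspaces, i.e. if, after a permutation of the coordinates, `A ⊆ ℕˢ × 0` and
`B ⊆ 0 × ℕⁿ⁻ˢ` for some `s`. -/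
def Transverse (A B : Set (Fin n →₀ ℕ)) : Prop :=
  ∃ S : Set (Fin n), (affineHull A : Set (Fin n → ℝ)) ⊆ coordSubspace S ∧
    (affineHull B : Set (Fin n → ℝ)) ⊆ coordSubspace Sᶜ

end Monomial

end TameBlowup

end

noncomputable section

namespace TameBlowup

open AlgebraicGeometry CategoryTheory

/-! ### Retracts of formally smooth algebras -/

/-! The blowup of `Spec R` in `I` is covered by charts with rings `R[I/a]`, `a` running through
generators of `I`. For a monomial ideal with exponents `A`, the chart of `a ∈ A` is the monoid
algebra of `chartMonoid A a`, the monoid generated by `ℕⁿ` and `A - a`; tameness says that these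
algebras are smooth over `K` (`isTame_monomialIdeal_iff`).

A product of monomial ideals has exponents `A + B`. If `A` and `B` use disjoint sets of variables,
an exponent in `chartMonoid (A + B) (a + b)` splits into a part in `chartMonoid A a` and a part in
`chartMonoid B b`. Splitting a monomial and multiplying the parts back makes the algebra of the
product chart a retract of the tensor product of the two given smooth algebras
(`smooth_chartMonoid_add`). It is only a retract because each factor already contains all `n`
variables. Formal smoothness passes to retracts by lifting through the larger algebra, and finite
presentation follows from finite type over a field. Induction on the number of factors concludes. -/

theorem formallySmooth_of_retract {R A B : Type*} [CommRing R] [CommRing A] [CommRing B]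
    [Algebra R A] [Algebra R B] [Algebra.FormallySmooth R A] (i : B →ₐ[R] A) (p : A →ₐ[R] B)
    (h : p.comp i = AlgHom.id R B) : Algebra.FormallySmooth R B := by
  refine .of_comp_surjective fun T _ _ J hJ f => ?_
  obtain ⟨g, hg⟩ := Algebra.FormallySmooth.comp_surjective R A J hJ (f.comp p)
  refine ⟨g.comp i, ?_⟩
  change ((Ideal.Quotient.mkₐ R J).comp g).comp i = f
  change (Ideal.Quotient.mkₐ R J).comp g = f.comp p at hg
  rw [hg, AlgHom.comp_assoc, h, AlgHom.comp_id]

/-! ### The charts of the blowup of an affine scheme -/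

section Charts

universe u

variable {R : Type u} [CommRing R] (I : Ideal R)

/-- The element `a * t` of the Rees algebra. -/
def reesGenerator (a : I) : reesAlgebra I :=
  ⟨Polynomial.monomial 1 (a : R), reesAlgebra.monomial_mem.2 (by simp)⟩

theorem reesGenerator_mem (a : I) : reesGenerator I a ∈ reesGrading I 1 :=
  ⟨a, rfl⟩

/-- The coordinate ring of the chart of the blowup in `I` on which `a` generates the pullback
of `I`. -/
abbrev chart (a : I) : Type u :=
  HomogeneousLocalization.Away (reesGrading I) (reesGenerator I a)

/-- The structure map of a chart. -/
def toChart (a : I) : R →+* chart I a :=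
  (HomogeneousLocalization.fromZeroRingHom (reesGrading I) _).comp
    (algebraMap R (reesGrading I 0))

/-- The Rees algebra is generated over `R` in degree one, where it is spanned by `a t` for
generators `a`; hence the corresponding charts cover the blowup. -/
theorem irrelevant_le_span_reesGenerator {s : Set R} (hs : Ideal.span s = I) :
    (HomogeneousIdeal.irrelevant (reesGrading I)).toIdeal ≤
      Ideal.span (Set.range fun a : {a : I // (a : R) ∈ s} => reesGenerator I a.1) := by
  set J := Ideal.span (Set.range fun a : {a : I // (a : R) ∈ s} => reesGenerator I a.1)
  have h1 : ∀ r (hr : r ∈ I), reesGenerator I ⟨r, hr⟩ ∈ J := by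
    intro r hr
    have hr' := hr
    rw [← hs] at hr'
    induction hr' using Submodule.span_induction with
    | mem x hx => exact Ideal.subset_span ⟨⟨⟨x, hr⟩, hx⟩, rfl⟩
    | zero =>
      convert J.zero_mem
      apply Subtype.ext
      simp [reesGenerator]
    | add x y hx hy ihx ihy =>
      have hx : x ∈ I := hs ▸ hx
      have hy : y ∈ I := hs ▸ hy
      convert J.add_mem (ihx hx) (ihy hy)
      apply Subtype.ext
      simp [reesGenerator]
    | smul c x hx ih =>
      have hx : x ∈ I := hs ▸ hx
      convert J.mul_mem_left (algebraMap R _ c) (ih hx)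
      apply Subtype.ext
      simp [reesGenerator, Polynomial.C_mul_monomial]
  have h2 : ∀ (m : ℕ) (r : R) (hr : r ∈ I ^ (m + 1)),
      (⟨Polynomial.monomial (m + 1) r, reesAlgebra.monomial_mem.2 hr⟩ : reesAlgebra I) ∈ J := by
    intro m r hr
    have hr' := hr
    rw [pow_succ] at hr'
    induction hr' using Submodule.mul_induction_on' with
    | mem_mul_mem x hx y hy =>
      convert J.mul_mem_left ⟨Polynomial.monomial m x, reesAlgebra.monomial_mem.2 hx⟩ (h1 y hy)
      simp [reesGenerator, Polynomial.monomial_mul_monomial]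
    | add x hx y hy ihx ihy =>
      rw [← pow_succ] at hx hy
      convert J.add_mem (ihx hx) (ihy hy)
      simp
  classical
  intro f hf
  -- The decomposition is an abstract choice, so the constant coefficient is read off from the sum
  -- of the components: only degree zero could contribute.
  have hf0 : (f : Polynomial R).coeff 0 = 0 := by
    rw [HomogeneousIdeal.mem_iff, HomogeneousIdeal.mem_irrelevant_iff,
      GradedRing.proj_apply] at hf
    have key := DirectSum.sum_support_decompose (reesGrading I) f
    have := congrArg (fun g : reesAlgebra I => (g : Polynomial R).coeff 0) key
    rw [← this]
    simp only [AddSubmonoidClass.coe_finsetSum, Polynomial.finsetSum_coeff]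
    refine Finset.sum_eq_zero fun i _ => ?_
    by_cases hi : i = 0
    · subst hi
      rw [hf]
      simp
    · rw [← mem_reesGrading_iff.1 (DirectSum.decompose (reesGrading I) f i).2,
        Polynomial.coeff_monomial_of_ne _ (Ne.symm hi)]
  have hsum : f = ∑ i ∈ (f : Polynomial R).support,
      (⟨Polynomial.monomial i ((f : Polynomial R).coeff i),
        reesAlgebra.monomial_mem.2 (f.2 i)⟩ : reesAlgebra I) := by
    apply Subtype.ext
    rw [AddSubmonoidClass.coe_finsetSum]
    exact (f : Polynomial R).as_sum_support
  rw [hsum]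
  refine J.sum_mem fun i hi => ?_
  cases i with
  | zero => exact absurd hf0 (by simpa using hi)
  | succ m => exact h2 m _ (f.2 (m + 1))

/-- Smoothness of a blowup can be tested on the charts given by a set of generators. -/
theorem smooth_blowup_iff {K : Type u} [CommRing K] [Algebra K R] {s : Set R}
    (hs : Ideal.span s = I) :
    Smooth (blowupMap I ≫ Spec.map (CommRingCat.ofHom (algebraMap K R))) ↔
      ∀ a : I, (a : R) ∈ s → ((toChart I a).comp (algebraMap K R)).Smooth := by
  let 𝒰 := Proj.affineOpenCoverOfIrrelevantLESpan (reesGrading I)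
    (fun a : {a : I // (a : R) ∈ s} => reesGenerator I a.1) (m := fun _ => 1)
    (fun a => reesGenerator_mem I a.1) (fun _ => one_pos)
    (irrelevant_le_span_reesGenerator I hs)
  have h (a : {a : I // (a : R) ∈ s}) :
      𝒰.openCover.f a ≫ blowupMap I ≫ Spec.map (CommRingCat.ofHom (algebraMap K R)) =
        Spec.map (CommRingCat.ofHom ((toChart I a.1).comp (algebraMap K R))) := by
    change Proj.awayι _ _ _ _ ≫ (_ ≫ _) ≫ _ = _
    rw [Category.assoc, Proj.awayι_toSpecZero_assoc, ← Spec.map_comp, ← Spec.map_comp]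
    rfl
  have : IsZariskiLocalAtSource @Smooth.{u} :=
    HasRingHomProperty.instIsZariskiLocalAtSource (Q := RingHom.Smooth)
  have h' : Smooth (blowupMap I ≫ Spec.map (CommRingCat.ofHom (algebraMap K R))) ↔
      ∀ a, Smooth (𝒰.openCover.f a ≫ blowupMap I ≫
        Spec.map (CommRingCat.ofHom (algebraMap K R))) :=
    IsZariskiLocalAtSource.iff_of_openCover (P := @Smooth.{u}) 𝒰.openCover
  rw [h', forall_congr' fun a => by rw [h a]]
  constructor
  · intro H a ha
    exact (HasRingHomProperty.Spec_iff (P := @Smooth)).1 (H ⟨a, ha⟩)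
  · intro H a
    exact (HasRingHomProperty.Spec_iff (P := @Smooth)).2 (H a.1 a.2)

variable {L : Type*} [CommRing L] (ι : R →+* L)

/-- If `u` is an inverse of `a` in `L`, the map from the chart of `a` to `L` which sends
`b t / a t` to `b u`. -/
def chartMap (a : I) (u : L) (hu : ι a * u = 1) : chart I a →+* L :=
  (IsLocalization.Away.lift (S := Localization.Away (reesGenerator I a)) (reesGenerator I a)
    (g := (Polynomial.eval₂RingHom ι u).comp (reesAlgebra I).val.toRingHom)
    (by simp [reesGenerator, hu])).comp
    (algebraMap (chart I a) (Localization.Away (reesGenerator I a)))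

variable {ι}

theorem chartMap_mk (a : I) (u : L) (hu : ι a * u = 1) (m : ℕ) (f : reesAlgebra I)
    (hf : f ∈ reesGrading I (m • 1)) :
    chartMap I ι a u hu (.mk _ (reesGenerator_mem I a) m f hf) =
      ι ((f : Polynomial R).coeff m) * u ^ m := by
  have hu' : ((Polynomial.eval₂RingHom ι u).comp (reesAlgebra I).val.toRingHom)
      (reesGenerator I a) = 1 := by simp [reesGenerator, hu]
  have hf' : Polynomial.monomial m ((f : Polynomial R).coeff m) = f := by
    simpa using mem_reesGrading_iff.1 hf
  -- Evaluation at `t = u` sends `a t` to `1`, so clearing the denominator does not change the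
  -- value.
  have h1 : chartMap I ι a u hu (.mk _ (reesGenerator_mem I a) m f hf) *
      ((Polynomial.eval₂RingHom ι u).comp (reesAlgebra I).val.toRingHom)
        (reesGenerator I a ^ m) =
      ((Polynomial.eval₂RingHom ι u).comp (reesAlgebra I).val.toRingHom) f := by
    rw [chartMap, RingHom.comp_apply, HomogeneousLocalization.algebraMap_apply,
      HomogeneousLocalization.Away.val_mk]
    have hunit : IsUnit (((Polynomial.eval₂RingHom ι u).comp (reesAlgebra I).val.toRingHom)
      (reesGenerator I a)) := by rw [hu']; exact isUnit_one
    rw [← IsLocalization.Away.lift_eq (S := Localization.Away (reesGenerator I a))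
      (reesGenerator I a) hunit, ← map_mul,
      ← IsLocalization.Away.lift_eq (S := Localization.Away (reesGenerator I a))
      (reesGenerator I a) hunit, Localization.mk_eq_mk']
    exact congrArg _ (IsLocalization.mk'_spec _ f
      (⟨reesGenerator I a ^ m, m, rfl⟩ : Submonoid.powers (reesGenerator I a)))
  rw [map_pow, hu', one_pow, mul_one] at h1
  rw [h1]
  conv_lhs => rw [RingHom.comp_apply]
  change Polynomial.eval₂ ι u (f : Polynomial R) = _
  rw [← hf', Polynomial.eval₂_monomial, Polynomial.coeff_monomial_same]

/-- Multiplying the image of a fraction `r t ^ m / (a t) ^ m` by `ι a ^ m` recovers `ι r`, hence the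
numerator. -/
theorem chartMap_injective (hι : Function.Injective ι) (a : I) (u : L) (hu : ι a * u = 1) :
    Function.Injective (chartMap I ι a u hu) := by
  rw [injective_iff_map_eq_zero]
  intro x hx
  obtain ⟨m, f, hf, rfl⟩ := HomogeneousLocalization.Away.mk_surjective _ (reesGenerator_mem I a) x
  rw [chartMap_mk] at hx
  have h0 : (f : Polynomial R).coeff m = 0 := by
    apply hι
    calc ι ((f : Polynomial R).coeff m)
        = ι ((f : Polynomial R).coeff m) * u ^ m * ι a ^ m := by
          rw [mul_assoc, ← mul_pow, mul_comm u, hu, one_pow, mul_one]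
      _ = ι 0 := by rw [hx, zero_mul, map_zero]
  have hf0 : f = 0 := by
    apply Subtype.ext
    have := mem_reesGrading_iff.1 hf
    rw [← this]
    simp [h0]
  subst hf0
  apply HomogeneousLocalization.val_injective
  simp [HomogeneousLocalization.Away.val_mk, Localization.mk_zero]

theorem chartMap_toChart (a : I) (u : L) (hu : ι a * u = 1) (r : R) :
    chartMap I ι a u hu (toChart I a r) = ι r := by
  have : toChart I a r = .mk _ (reesGenerator_mem I a) 0 (algebraMap R _ r)
      (by
        rw [zero_smul]
        exact ⟨r, rfl⟩) := by
    apply HomogeneousLocalization.val_injective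
    simp [toChart, HomogeneousLocalization.Away.val_mk, HomogeneousLocalization.fromZeroRingHom]
    rfl
  rw [this, chartMap_mk]
  simp

theorem mul_mem_range_chartMap (a : I) (u : L) (hu : ι a * u = 1) {r : R} (hr : r ∈ I) :
    ι r * u ∈ Set.range (chartMap I ι a u hu) :=
  ⟨.mk _ (reesGenerator_mem I a) 1 (reesGenerator I ⟨r, hr⟩) (reesGenerator_mem I _), by
    rw [chartMap_mk]
    simp [reesGenerator]⟩

/-- The chart of `a` embeds as the smallest subring containing `R` and `I / a`. -/
theorem chartMap_mem (a : I) (u : L) (hu : ι a * u = 1) {s : Set R}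
    (hs : Ideal.span s = I) (T : Subring L) (h₀ : ∀ r, ι r ∈ T) (h₁ : ∀ r ∈ s, ι r * u ∈ T)
    (x : chart I a) : chartMap I ι a u hu x ∈ T := by
  have key : ∀ m, ∀ r ∈ I ^ m, ι r * u ^ m ∈ T := by
    have key1 : ∀ r ∈ I, ι r * u ∈ T := by
      intro r hr
      rw [← hs] at hr
      induction hr using Submodule.span_induction with
      | mem x hx => exact h₁ x hx
      | zero => simp
      | add x y _ _ hx hy =>
        rw [map_add, add_mul]
        exact T.add_mem hx hy
      | smul c x _ hx =>
        rw [smul_eq_mul, map_mul, mul_assoc]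
        exact T.mul_mem (h₀ c) hx
    intro m
    induction m with
    | zero => simpa using h₀
    | succ m ih =>
      intro r hr
      rw [pow_succ] at hr
      induction hr using Submodule.mul_induction_on' with
      | mem_mul_mem x hx y hy =>
        rw [map_mul, pow_succ, mul_mul_mul_comm]
        exact T.mul_mem (ih x hx) (key1 y hy)
      | add x _ y _ hx hy =>
        rw [map_add, add_mul]
        exact T.add_mem hx hy
  obtain ⟨m, f, hf, rfl⟩ := HomogeneousLocalization.Away.mk_surjective _ (reesGenerator_mem I a) x
  rw [chartMap_mk]
  exact key m _ (f.2 m)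

end Charts

/-! ### The charts of the blowup of affine space in a monomial ideal -/

section Toric

open scoped TensorProduct

universe u

variable {K : Type u} [Field K] {n : ℕ}

/-- The inclusion of `ℕⁿ` in `ℤⁿ`. -/
def intExponent : (Fin n →₀ ℕ) →+ (Fin n → ℤ) where
  toFun a i := a i
  map_zero' := by ext; simp
  map_add' a b := by ext; simp

@[simp]
theorem intExponent_apply (a : Fin n →₀ ℕ) (i : Fin n) : intExponent a i = a i := rfl

theorem intExponent_injective : Function.Injective (intExponent (n := n)) := by
  intro a b h
  ext i
  simpa using congrFun h i

/-- The submonoid of `ℤⁿ` generated by `ℕⁿ` and `A - a`. -/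
def chartMonoid (A : Set (Fin n →₀ ℕ)) (a : Fin n →₀ ℕ) : AddSubmonoid (Fin n → ℤ) :=
  AddSubmonoid.closure (Set.range intExponent ∪ (fun b => intExponent b - intExponent a) '' A)

theorem intExponent_mem_chartMonoid (A : Set (Fin n →₀ ℕ)) (a b : Fin n →₀ ℕ) :
    intExponent b ∈ chartMonoid A a :=
  AddSubmonoid.subset_closure (Or.inl ⟨b, rfl⟩)

theorem sub_mem_chartMonoid {A : Set (Fin n →₀ ℕ)} (a : Fin n →₀ ℕ) {b : Fin n →₀ ℕ}
    (hb : b ∈ A) : intExponent b - intExponent a ∈ chartMonoid A a :=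
  AddSubmonoid.subset_closure (Or.inr ⟨b, hb, rfl⟩)

theorem chartMonoid_le {A : Set (Fin n →₀ ℕ)} {a : Fin n →₀ ℕ} {M : AddSubmonoid (Fin n → ℤ)}
    (h₀ : ∀ b, intExponent b ∈ M) (h₁ : ∀ b ∈ A, intExponent b - intExponent a ∈ M) :
    chartMonoid A a ≤ M := by
  rw [chartMonoid, AddSubmonoid.closure_le]
  rintro _ (⟨b, rfl⟩ | ⟨b, hb, rfl⟩)
  · exact h₀ b
  · exact h₁ b hb

variable (K) in
/-- The inclusion of the polynomial ring in the ring of Laurent polynomials. -/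
def toLaurent : MvPolynomial (Fin n) K →ₐ[K] AddMonoidAlgebra K (Fin n → ℤ) :=
  AddMonoidAlgebra.mapDomainAlgHom K K intExponent

theorem toLaurent_monomial (a : Fin n →₀ ℕ) (c : K) :
    toLaurent K (MvPolynomial.monomial a c) = AddMonoidAlgebra.single (intExponent a) c :=
  AddMonoidAlgebra.mapDomain_single

theorem toLaurent_injective : Function.Injective (toLaurent K (n := n)) :=
  AddMonoidAlgebra.mapDomain_injective intExponent_injective

variable (K) in
/-- The inclusion of the algebra of a submonoid of `ℤⁿ` in the ring of Laurent polynomials. -/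
def submonoidInclusion (M : AddSubmonoid (Fin n → ℤ)) :
    AddMonoidAlgebra K M →ₐ[K] AddMonoidAlgebra K (Fin n → ℤ) :=
  AddMonoidAlgebra.mapDomainAlgHom K K M.subtype

theorem submonoidInclusion_single (M : AddSubmonoid (Fin n → ℤ)) (m : M) (c : K) :
    submonoidInclusion K M (AddMonoidAlgebra.single m c) =
      AddMonoidAlgebra.single (m : Fin n → ℤ) c :=
  AddMonoidAlgebra.mapDomain_single

theorem submonoidInclusion_injective (M : AddSubmonoid (Fin n → ℤ)) :
    Function.Injective (submonoidInclusion K M) :=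
  AddMonoidAlgebra.mapDomain_injective Subtype.val_injective

theorem monomial_mem_monomialIdeal {A : Set (Fin n →₀ ℕ)} {a : Fin n →₀ ℕ} (ha : a ∈ A) :
    MvPolynomial.monomial a (1 : K) ∈ monomialIdeal K A :=
  Ideal.subset_span ⟨a, ha, rfl⟩

variable (K) in
/-- The chart of the blowup in a monomial ideal given by one of the generators. -/
abbrev monomialChart (A : Set (Fin n →₀ ℕ)) (a : A) : Type u :=
  chart (monomialIdeal K A) ⟨_, monomial_mem_monomialIdeal a.2⟩

variable (K) in
/-- The inclusion of a chart of the blowup in a monomial ideal in the ring of Laurent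
polynomials. -/
def monomialChartMap (A : Set (Fin n →₀ ℕ)) (a : A) :
    monomialChart K A a →+* AddMonoidAlgebra K (Fin n → ℤ) :=
  chartMap (monomialIdeal K A) (toLaurent K).toRingHom ⟨_, monomial_mem_monomialIdeal a.2⟩
    (AddMonoidAlgebra.single (-intExponent a.1) 1) (by
      change toLaurent K (MvPolynomial.monomial a.1 1) * _ = 1
      rw [toLaurent_monomial, AddMonoidAlgebra.single_mul_single, add_neg_cancel, mul_one]
      rfl)

/-- Both sides are the smallest subring of the Laurent polynomials containing all polynomials and
the monomials with exponents `b - a`, `b ∈ A`. -/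
theorem range_monomialChartMap (A : Set (Fin n →₀ ℕ)) (a : A) :
    Set.range (monomialChartMap K A a) = Set.range (submonoidInclusion K (chartMonoid A a)) := by
  have hmul (b : Fin n →₀ ℕ) (c : K) :
      (toLaurent K).toRingHom (MvPolynomial.monomial b c) *
        AddMonoidAlgebra.single (-intExponent a.1) 1 =
      AddMonoidAlgebra.single (intExponent b - intExponent a.1) c := by
    change toLaurent K (MvPolynomial.monomial b c) * _ = _
    rw [toLaurent_monomial, AddMonoidAlgebra.single_mul_single, mul_one, sub_eq_add_neg]
  apply Set.Subset.antisymm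
  · rintro _ ⟨x, rfl⟩
    refine chartMap_mem _ _ _ _ rfl (submonoidInclusion K (chartMonoid A a)).toRingHom.range
      (fun r => ?_) ?_ x
    · induction r using MvPolynomial.induction_on' with
      | monomial b c =>
        exact ⟨AddMonoidAlgebra.single ⟨_, intExponent_mem_chartMonoid A a.1 b⟩ c,
          (submonoidInclusion_single _ _ _).trans (toLaurent_monomial b c).symm⟩
      | add p q hp hq =>
        rw [map_add]
        exact Subring.add_mem _ hp hq
    · rintro _ ⟨b, hb, rfl⟩
      exact ⟨AddMonoidAlgebra.single ⟨_, sub_mem_chartMonoid a.1 hb⟩ 1,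
        (submonoidInclusion_single _ _ _).trans (hmul b 1).symm⟩
  · let T : Subring (AddMonoidAlgebra K (Fin n → ℤ)) :=
      RingHom.range (R := monomialChart K A a) (monomialChartMap K A a)
    have hT : ∀ r, toLaurent K r ∈ T := fun r => ⟨toChart _ _ r, chartMap_toChart _ _ _ _ r⟩
    -- Exponents whose monomial lies in the subring `T` form a submonoid, so the generators suffice.
    have hM : chartMonoid A a.1 ≤
        { carrier := {m | AddMonoidAlgebra.single m (1 : K) ∈ T}
          zero_mem' := T.one_mem
          add_mem' := fun {x y} hx hy => by
            have := T.mul_mem hx hy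
            rwa [AddMonoidAlgebra.single_mul_single, mul_one] at this } := by
      refine chartMonoid_le (fun b => ?_) (fun b hb => ?_)
      · change AddMonoidAlgebra.single (intExponent b) (1 : K) ∈ T
        rw [← toLaurent_monomial]
        exact hT _
      · change AddMonoidAlgebra.single (intExponent b - intExponent a.1) (1 : K) ∈ T
        rw [← hmul]
        exact mul_mem_range_chartMap _ _ _ _ (monomial_mem_monomialIdeal hb)
    rintro _ ⟨x, rfl⟩
    change _ ∈ T
    induction x using AddMonoidAlgebra.induction_linear with
    | zero => simp
    | add p q hp hq =>
      rw [map_add]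
      exact T.add_mem hp hq
    | single m c =>
      have h1 : AddMonoidAlgebra.single (0 : Fin n → ℤ) c ∈ T := by
        have := hT (MvPolynomial.monomial 0 c)
        rwa [toLaurent_monomial, map_zero] at this
      have := T.mul_mem h1 (hM m.2)
      rwa [AddMonoidAlgebra.single_mul_single, mul_one, zero_add,
        ← submonoidInclusion_single] at this

theorem smooth_monomialChart_iff (A : Set (Fin n →₀ ℕ)) (a : A) :
    ((toChart (monomialIdeal K A) ⟨_, monomial_mem_monomialIdeal a.2⟩).comp
      (algebraMap K (MvPolynomial (Fin n) K))).Smooth ↔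
    Algebra.Smooth K (AddMonoidAlgebra K (chartMonoid A a)) := by
  have hinj : Function.Injective (monomialChartMap K A a) :=
    chartMap_injective _ toLaurent_injective _ _ _
  have hinj' := submonoidInclusion_injective (K := K) (chartMonoid A a.1)
  have hf (x : monomialChart K A a) :
      ∃ y, submonoidInclusion K (chartMonoid A a.1) y = monomialChartMap K A a x :=
    (range_monomialChartMap A a).le ⟨x, rfl⟩
  choose f hf using hf
  -- Both rings embed in the Laurent polynomials with the same image; all identities are checked
  -- there.
  let e : monomialChart K A a ≃+* AddMonoidAlgebra K (chartMonoid A a.1) :=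
    RingEquiv.ofBijective
      ({ toFun := f
         map_one' := hinj' (by rw [hf, map_one, map_one])
         map_zero' := hinj' (by rw [hf, map_zero, map_zero])
         map_mul' := fun x y => hinj' (by rw [hf, map_mul, map_mul, hf, hf])
         map_add' := fun x y => hinj' (by rw [hf, map_add, map_add, hf, hf]) } :
        monomialChart K A a →+* AddMonoidAlgebra K (chartMonoid A a.1))
      ⟨fun x y h => hinj (by rw [← hf, ← hf]; exact congrArg _ h), fun y => by
        obtain ⟨x, hx⟩ := (range_monomialChartMap A a).ge ⟨y, rfl⟩
        exact ⟨x, hinj' ((hf x).trans hx)⟩⟩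
  have he : e.toRingHom.comp ((toChart (monomialIdeal K A)
      ⟨_, monomial_mem_monomialIdeal a.2⟩).comp (algebraMap K (MvPolynomial (Fin n) K))) =
      algebraMap K _ := by
    ext1 c
    apply hinj'
    rw [AlgHom.commutes]
    refine (hf _).trans ((chartMap_toChart _ _ _ _ _).trans ?_)
    exact (toLaurent K).commutes c
  have he' : e.symm.toRingHom.comp (algebraMap K (AddMonoidAlgebra K (chartMonoid A a.1))) =
      (toChart (monomialIdeal K A) ⟨_, monomial_mem_monomialIdeal a.2⟩).comp
        (algebraMap K (MvPolynomial (Fin n) K)) := by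
    rw [← he]
    ext1 c
    exact e.symm_apply_apply _
  rw [← RingHom.smooth_algebraMap]
  constructor
  · intro h
    rw [← he]
    exact RingHom.Smooth.respectsIso.1 _ e h
  · intro h
    rw [← he']
    refine h.comp (RingHom.Smooth.of_bijective ?_)
    exact e.symm.bijective

theorem isTame_monomialIdeal_iff (A : Set (Fin n →₀ ℕ)) :
    IsTame (monomialIdeal K A) ↔
      ∀ a ∈ A, Algebra.Smooth K (AddMonoidAlgebra K (chartMonoid A a)) := by
  rw [IsTame, smooth_blowup_iff (monomialIdeal K A) rfl]
  constructor
  · intro h a ha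
    exact (smooth_monomialChart_iff A ⟨a, ha⟩).1 (h _ ⟨a, ha, rfl⟩)
  · rintro h ⟨_, _⟩ ⟨a, ha, rfl⟩
    exact (smooth_monomialChart_iff A ⟨a, ha⟩).2 (h a ha)

/-! ### Products of transverse monomial ideals -/

/-- The projection of `ℤⁿ` to the coordinate subspace given by `S`. -/
def coordProj (S : Set (Fin n)) : (Fin n → ℤ) →+ (Fin n → ℤ) where
  toFun m := S.indicator m
  map_zero' := Set.indicator_zero' _
  map_add' := Set.indicator_add _

theorem coordProj_add_compl (S : Set (Fin n)) (m : Fin n → ℤ) :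
    coordProj S m + coordProj Sᶜ m = m :=
  Set.indicator_self_add_compl S m

/-- All exponent vectors in `A` only involve the variables in `S`. -/
def SupportedIn (A : Set (Fin n →₀ ℕ)) (S : Set (Fin n)) : Prop :=
  ∀ a ∈ A, ∀ i, a i ≠ 0 → i ∈ S

theorem SupportedIn.coordProj {A : Set (Fin n →₀ ℕ)} {S : Set (Fin n)} (hA : SupportedIn A S)
    {a : Fin n →₀ ℕ} (ha : a ∈ A) : coordProj S (intExponent a) = intExponent a := by
  refine Set.indicator_eq_self.2 fun i hi => hA a ha i ?_
  simpa using hi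

theorem SupportedIn.coordProj_compl {A : Set (Fin n →₀ ℕ)} {S : Set (Fin n)}
    (hA : SupportedIn A S) {a : Fin n →₀ ℕ} (ha : a ∈ A) :
    TameBlowup.coordProj Sᶜ (intExponent a) = 0 := by
  have := coordProj_add_compl S (intExponent a)
  rwa [hA.coordProj ha, add_eq_left] at this

theorem coordProj_mem_chartMonoid (A : Set (Fin n →₀ ℕ)) (a b : Fin n →₀ ℕ) (S : Set (Fin n)) :
    coordProj S (intExponent b) ∈ chartMonoid A a := by
  classical
  have : coordProj S (intExponent b) = intExponent (b.filter (· ∈ S)) := by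
    ext i
    by_cases hi : i ∈ S <;> simp [coordProj, hi]
  rw [this]
  exact intExponent_mem_chartMonoid A a _

open scoped Pointwise in
theorem smooth_chartMonoid_add {A B : Set (Fin n →₀ ℕ)} {S : Set (Fin n)}
    (hA : SupportedIn A S) (hB : SupportedIn B Sᶜ) {a b : Fin n →₀ ℕ} (ha : a ∈ A) (hb : b ∈ B)
    [hsA : Algebra.Smooth K (AddMonoidAlgebra K (chartMonoid A a))]
    [hsB : Algebra.Smooth K (AddMonoidAlgebra K (chartMonoid B b))] :
    Algebra.Smooth K (AddMonoidAlgebra K (chartMonoid (A + B) (a + b))) := by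
  have hB' : ∀ {c}, c ∈ B → coordProj S (intExponent c) = 0 := fun hc => by
    simpa using hB.coordProj_compl hc
  -- Freezing the second summand at `b` turns differences in `A + B` into differences in `A`.
  have hAle : chartMonoid A a ≤ chartMonoid (A + B) (a + b) := by
    refine chartMonoid_le (intExponent_mem_chartMonoid _ _) fun c hc => ?_
    have := sub_mem_chartMonoid (a + b) (Set.add_mem_add hc hb)
    rwa [map_add, map_add, add_sub_add_right_eq_sub] at this
  have hBle : chartMonoid B b ≤ chartMonoid (A + B) (a + b) := by
    refine chartMonoid_le (intExponent_mem_chartMonoid _ _) fun c hc => ?_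
    have := sub_mem_chartMonoid (a + b) (Set.add_mem_add ha hc)
    rwa [map_add, map_add, add_sub_add_left_eq_sub] at this
  -- Projection to `S` kills `B` and fixes `A`, so `(c + d) - (a + b)` becomes `c - a`.
  have hpA : chartMonoid (A + B) (a + b) ≤ (chartMonoid A a).comap (coordProj S) := by
    refine chartMonoid_le (fun c => coordProj_mem_chartMonoid _ _ _ _) ?_
    rintro _ ⟨c, hc, d, hd, rfl⟩
    rw [AddSubmonoid.mem_comap, map_sub]
    simp only [map_add]
    rw [hA.coordProj hc, hA.coordProj ha, hB' hd, hB' hb, add_zero, add_zero]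
    exact sub_mem_chartMonoid a hc
  have hpB : chartMonoid (A + B) (a + b) ≤ (chartMonoid B b).comap (coordProj Sᶜ) := by
    refine chartMonoid_le (fun c => coordProj_mem_chartMonoid _ _ _ _) ?_
    rintro _ ⟨c, hc, d, hd, rfl⟩
    rw [AddSubmonoid.mem_comap, map_sub]
    simp only [map_add]
    rw [hB.coordProj hd, hB.coordProj hb, hA.coordProj_compl hc, hA.coordProj_compl ha, zero_add,
      zero_add]
    exact sub_mem_chartMonoid b hd
  let M := chartMonoid (A + B) (a + b)
  let C := AddMonoidAlgebra K (chartMonoid A a) ⊗[K] AddMonoidAlgebra K (chartMonoid B b)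
  let qA : M →+ chartMonoid A a :=
    ((coordProj S).comp M.subtype).codRestrict _ fun m => hpA m.2
  let qB : M →+ chartMonoid B b :=
    ((coordProj Sᶜ).comp M.subtype).codRestrict _ fun m => hpB m.2
  let i : AddMonoidAlgebra K M →ₐ[K] C := AddMonoidAlgebra.lift K C M
    { toFun := fun m => AddMonoidAlgebra.single (qA m.toAdd) 1 ⊗ₜ
        AddMonoidAlgebra.single (qB m.toAdd) 1
      map_one' := by
        simp only [toAdd_one, map_zero]
        rfl
      map_mul' := fun x y => by
        rw [Algebra.TensorProduct.tmul_mul_tmul, AddMonoidAlgebra.single_mul_single,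
          AddMonoidAlgebra.single_mul_single, toAdd_mul, map_add, map_add, mul_one] }
  let p : C →ₐ[K] AddMonoidAlgebra K M := Algebra.TensorProduct.productMap
    (AddMonoidAlgebra.mapDomainAlgHom K K (AddSubmonoid.inclusion hAle))
    (AddMonoidAlgebra.mapDomainAlgHom K K (AddSubmonoid.inclusion hBle))
  have hpi : p.comp i = AlgHom.id K _ := by
    refine AddMonoidAlgebra.algHom_ext (fun m => ?_) (by ext)
    have hm : AddSubmonoid.inclusion hAle (qA m) + AddSubmonoid.inclusion hBle (qB m) = m :=
      Subtype.ext (coordProj_add_compl S m)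
    have him : i (AddMonoidAlgebra.single m 1) = AddMonoidAlgebra.single (qA m) 1 ⊗ₜ
        AddMonoidAlgebra.single (qB m) 1 := by
      rw [AddMonoidAlgebra.lift_single, one_smul]
      rfl
    rw [AlgHom.comp_apply, him, Algebra.TensorProduct.productMap_apply_tmul]
    refine (congrArg₂ (· * ·) AddMonoidAlgebra.mapDomain_single
      AddMonoidAlgebra.mapDomain_single).trans ?_
    rw [AddMonoidAlgebra.single_mul_single, mul_one]
    exact congrArg (AddMonoidAlgebra.single · 1) hm
  -- Base change of the second algebra along the first, followed by composition.
  have hC : Algebra.Smooth K C := .comp K (AddMonoidAlgebra K (chartMonoid A a)) C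
  have hfs : Algebra.FormallySmooth K (AddMonoidAlgebra K M) := formallySmooth_of_retract i p hpi
  have hft : Algebra.FiniteType K (AddMonoidAlgebra K M) :=
    .of_surjective p fun x => ⟨i x, DFunLike.congr_fun hpi x⟩
  exact ⟨hfs, Algebra.FinitePresentation.of_finiteType.1 hft⟩

open scoped Pointwise in
theorem monomialIdeal_mul (A B : Set (Fin n →₀ ℕ)) :
    monomialIdeal K A * monomialIdeal K B = monomialIdeal K (A + B) := by
  rw [monomialIdeal, monomialIdeal, monomialIdeal, Ideal.span_mul_span']
  congr 1
  ext f
  constructor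
  · rintro ⟨_, ⟨a, ha, rfl⟩, _, ⟨b, hb, rfl⟩, rfl⟩
    exact ⟨a + b, Set.add_mem_add ha hb, by simp [MvPolynomial.monomial_mul]⟩
  · rintro ⟨_, ⟨a, ha, b, hb, rfl⟩, rfl⟩
    exact ⟨_, ⟨a, ha, rfl⟩, _, ⟨b, hb, rfl⟩, by simp [MvPolynomial.monomial_mul]⟩

theorem isTame_mul {A B : Set (Fin n →₀ ℕ)} {S : Set (Fin n)} (hA : SupportedIn A S)
    (hB : SupportedIn B Sᶜ) (htA : IsTame (monomialIdeal K A))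
    (htB : IsTame (monomialIdeal K B)) :
    IsTame (monomialIdeal K A * monomialIdeal K B) := by
  rw [isTame_monomialIdeal_iff] at htA htB
  rw [monomialIdeal_mul, isTame_monomialIdeal_iff]
  rintro _ ⟨a, ha, b, hb, rfl⟩
  have := htA a ha
  have := htB b hb
  exact smooth_chartMonoid_add hA hB ha hb

theorem monomialIdeal_zero : monomialIdeal K ({0} : Set (Fin n →₀ ℕ)) = ⊤ := by
  rw [monomialIdeal, Set.image_singleton, Ideal.eq_top_iff_one]
  exact Ideal.subset_span rfl

-- The empty product: for the exponent set `{0}` the only chart is affine space itself.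
variable (K n) in
theorem isTame_top : IsTame (⊤ : Ideal (MvPolynomial (Fin n) K)) := by
  rw [← monomialIdeal_zero, isTame_monomialIdeal_iff]
  rintro _ rfl
  let e : (Fin n →₀ ℕ) ≃+ chartMonoid (n := n) {0} 0 := AddEquiv.ofBijective
    (intExponent.codRestrict _ fun b => intExponent_mem_chartMonoid _ _ b) (by
      refine ⟨fun x y h => intExponent_injective (congrArg Subtype.val h), ?_⟩
      have h : chartMonoid (n := n) {0} 0 ≤ AddMonoidHom.mrange intExponent := by
        refine chartMonoid_le (fun b => ⟨b, rfl⟩) ?_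
        rintro _ rfl
        exact ⟨0, by simp⟩
      rintro ⟨m, hm⟩
      obtain ⟨b, hb⟩ := h hm
      exact ⟨b, Subtype.ext hb⟩)
  have : Algebra.Smooth K (MvPolynomial (Fin n) K) := ⟨inferInstance, inferInstance⟩
  exact Algebra.Smooth.of_equiv (AddMonoidAlgebra.domCongr K K e)

theorem Transverse.disjoint {A B : Set (Fin n →₀ ℕ)} (h : Transverse A B) {a b : Fin n →₀ ℕ}
    (ha : a ∈ A) (hb : b ∈ B) (i : Fin n) : a i = 0 ∨ b i = 0 := by
  have key : ∀ (T : Set (Fin n)) (x : Fin n → ℝ), x ∈ coordSubspace T → ∀ i ∉ T, x i = 0 := by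
    intro T x hx i hi
    induction hx using Submodule.span_induction with
    | mem x hx =>
      obtain ⟨j, hj, rfl⟩ := hx
      exact Pi.single_eq_of_ne (by rintro rfl; exact hi hj) _
    | zero => rfl
    | add x y _ _ hx hy => simp [hx, hy]
    | smul c x _ hx => simp [hx]
  obtain ⟨S, hA, hB⟩ := h
  by_cases hi : i ∈ S
  · right
    simpa using key _ _ (hB (subset_affineSpan ℝ _ ⟨b, hb, rfl⟩)) i (by simpa using hi)
  · left
    simpa using key _ _ (hA (subset_affineSpan ℝ _ ⟨a, ha, rfl⟩)) i hi

open scoped Pointwise in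
theorem isTame_prod {ι : Type*} (s : Finset ι) (A : ι → Set (Fin n →₀ ℕ))
    (htr : Pairwise fun i j => Transverse (A i) (A j))
    (htame : ∀ i, IsTame (monomialIdeal K (A i))) :
    IsTame (∏ i ∈ s, monomialIdeal K (A i)) := by
  classical
  -- Tracking which variables the partial product uses lets pairwise transversality separate the
  -- next factor from all previous ones at once.
  suffices h : ∃ B, SupportedIn B {x | ∃ i ∈ s, ∃ a ∈ A i, a x ≠ 0} ∧
      ∏ i ∈ s, monomialIdeal K (A i) = monomialIdeal K B ∧ IsTame (monomialIdeal K B) by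
    obtain ⟨B, -, h, hB⟩ := h
    rwa [h]
  induction s using Finset.induction_on with
  | empty =>
    refine ⟨{0}, ?_, ?_, ?_⟩
    · rintro _ rfl i hi
      exact absurd rfl hi
    · rw [Finset.prod_empty, monomialIdeal_zero, Ideal.one_eq_top]
    · rw [monomialIdeal_zero]
      exact isTame_top K n
  | insert j s hj ih =>
    obtain ⟨B, hBs, hB, hBt⟩ := ih
    refine ⟨A j + B, ?_, ?_, ?_⟩
    · rintro _ ⟨a, ha, b, hb, rfl⟩ x hx
      by_cases hax : a x = 0
      · obtain ⟨i, hi, c, hc⟩ := hBs b hb x (by simpa [hax] using hx)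
        exact ⟨i, Finset.mem_insert_of_mem hi, c, hc⟩
      · exact ⟨j, Finset.mem_insert_self _ _, a, ha, hax⟩
    · rw [Finset.prod_insert hj, hB, monomialIdeal_mul]
    · rw [← monomialIdeal_mul]
      refine isTame_mul (S := {x | ∃ a ∈ A j, a x ≠ 0}) (fun a ha x hx => ⟨a, ha, hx⟩) ?_
        (htame j) hBt
      rintro b hb x hx ⟨a, ha, hax⟩
      obtain ⟨i, hi, c, hc, hcx⟩ := hBs b hb x hx
      have hij : i ≠ j := fun h => hj (h ▸ hi)
      exact ((htr hij).disjoint hc ha x).elim hcx hax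

end Toric

end TameBlowup

end

theorem mainTheorem7 {K : Type*} [Field K] {n k : ℕ}
    (I : Fin k → Ideal (MvPolynomial (Fin n) K))
    (A : Fin k → Set (Fin n →₀ ℕ))
    (hA : ∀ i, TameBlowup.IsCloud (A i) (I i))
    (htransverse : Pairwise fun i j => TameBlowup.Transverse (A i) (A j))
    (htame : ∀ i, TameBlowup.IsTame (I i)) :
    TameBlowup.IsTame (∏ i, I i) := by
  have hI : I = fun i => TameBlowup.monomialIdeal K (A i) := funext fun i => (hA i).prop.symm
  subst hI
  exact TameBlowup.isTame_prod Finset.univ A htransverse htame
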